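/- **Theorem 3.1 (Mayer–Vietoris).** Let $M$ be a smooth ($C^\infty$) manifold, possibly with boundary or corners (finite-dimensional, Hausdorff, second countable), and let $U, V \subseteq M$ be open subsets with $M = U \cup V$. For a smooth manifold $X$ let $\Omega^k(X)$ be the real vector space of smooth differential $k$-forms on $X$ ($k \ge 0$), $d : \Omega^k(X) \to \Omega^{k+1}(X)$ the exterior derivative, and $$H^k(X) = \ker\big(d : \Omega^k(X) \to \Omega^{k+1}(X)\big) \big/ d\big(\Omega^{k-1}(X)\big), \qquad \Omega^{-1}(X) = 0,$$ the de Rham cohomology. Open subsets of $M$ are regarded as manifolds, and restriction of forms is pullback along the inclusion. Put $$i(\omega) = (\omega|_U, \omega|_V), \qquad j(\omega, \eta) = \omega|_{U \cap V} - \eta|_{U \cap V}.$$ Then $i$ and $j$ commute with the differentials ($d \oplus d$ on $\Omega^*(U) \oplus \Omega^*(V)$), and $$0 \to \Omega^*(M) \xrightarrow{\ i\ } \Omega^*(U) \oplus \Omega^*(V) \xrightarrow{\ j\ } \Omega^*(U \cap V) \to 0$$ is a short exact sequence of cochain complexes, that is, for every $k \ge 0$ the sequence in degree $k$ is exact. Let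 $i^*[\omega] = ([\omega|_U], [\omega|_V])$ and $j^*([\omega], [\eta]) = [\omega|_{U \cap V}] - [\eta|_{U \cap V}]$ be the induced maps in cohomology. Then there are linear maps $\delta : H^k(U \cap V) \to H^{k+1}(M)$, $k \ge 0$ (the connecting homomorphisms), such that $\delta[\sigma] = [\tau]$ whenever $\sigma \in \Omega^k(U \cap V)$ and $\tau \in \Omega^{k+1}(M)$ are closed and there is $(\omega, \eta) \in \Omega^k(U) \oplus \Omega^k(V)$ with $j(\omega, \eta) = \sigma$ and $i(\tau) = (d\omega, d\eta)$, and such that the sequence $$0 \to H^0(M) \xrightarrow{i^*} H^0(U) \oplus H^0(V) \xrightarrow{j^*} H^0(U \cap V) \xrightarrow{\delta} H^1(M) \xrightarrow{i^*} \cdots \xrightarrow{\delta} H^k(M) \xrightarrow{i^*} H^k(U) \oplus H^k(V) \xrightarrow{j^*} H^k(U \cap V) \xrightarrow{\delta} H^{k+1}(M) \xrightarrow{i^*} \cdots$$ is exact. -/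

import Mathlib

open scoped Manifold ContDiff Topology
open TopologicalSpace

noncomputable section

namespace DeRham

section Forms

variable {E : Type*} [NormedAddCommGroup E] [NormedSpace ℝ E]
  {H : Type*} [TopologicalSpace H] (I : ModelWithCorners ℝ E H)
  (M : Type*) [TopologicalSpace M] [ChartedSpace H M]

/-- Fields of alternating `k`-linear forms on the tangent spaces of `M`, with no smoothness
assumption. -/
abbrev FormField (k : ℕ) := (x : M) → TangentSpace I x [⋀^Fin k]→L[ℝ] ℝ

variable {I M}

/-- The expression of a field of alternating forms in the preferred chart `φ` at `x₀`: the pullback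
of the field under `φ⁻¹`, a field of alternating forms on (the image of the chart in) the model
vector space `E`. Derivatives are taken within `range I`, which is all of `E` for a manifold without
boundary and a half-space for a manifold with boundary. -/
def chartRep {k : ℕ} (α : FormField I M k) (x₀ : M) (y : E) : E [⋀^Fin k]→L[ℝ] ℝ :=
  (α ((extChartAt I x₀).symm y)).compContinuousLinearMap
    (mfderivWithin 𝓘(ℝ, E) I (extChartAt I x₀).symm (Set.range I) y)

theorem chartRep_add {k : ℕ} (α β : FormField I M k) (x₀ : M) :
    chartRep (α + β) x₀ = chartRep α x₀ + chartRep β x₀ := rfl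

theorem chartRep_smul {k : ℕ} (c : ℝ) (α : FormField I M k) (x₀ : M) :
    chartRep (c • α) x₀ = c • chartRep α x₀ := rfl

variable (I M)

/-- The fields of alternating `k`-linear forms on the tangent spaces whose expressions in the charts
are smooth. -/
def smoothForms (k : ℕ) : Submodule ℝ (FormField I M k) where
  carrier := {α | ∀ x₀ : M, ContDiffOn ℝ ∞ (chartRep α x₀) (extChartAt I x₀).target}
  add_mem' hα hβ x₀ := by
    rw [chartRep_add]
    exact (hα x₀).add (hβ x₀)
  zero_mem' x₀ := by
    have : chartRep (0 : FormField I M k) x₀ = 0 := by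
      ext y v
      rfl
    rw [this]
    exact contDiffOn_const
  smul_mem' c α hα x₀ := by
    rw [chartRep_smul]
    exact (hα x₀).const_smul c

variable {I M}

/-- The exterior derivative of a field of alternating forms: at the point `x`, it is the exterior
derivative of the expression in the preferred chart `φ` at `x`, pulled back under `φ`. For smooth
forms any other chart at `x` gives the same result, see `chartRep_extDerivField`. -/
def extDerivField {k : ℕ} (α : FormField I M k) : FormField I M (k + 1) := fun x =>
  (extDerivWithin (chartRep α x) (Set.range I) (extChartAt I x x)).compContinuousLinearMap
    (mfderiv I 𝓘(ℝ, E) (extChartAt I x) x)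

variable {E' : Type*} [NormedAddCommGroup E'] [NormedSpace ℝ E']
  {H' : Type*} [TopologicalSpace H'] {I' : ModelWithCorners ℝ E' H'}
  {N : Type*} [TopologicalSpace N] [ChartedSpace H' N]

/-- The pullback `(f^* α)_x (v₁, …, v_k) = α_{f x} (df_x v₁, …, df_x v_k)`. -/
def pullbackField {k : ℕ} (f : M → N) (α : FormField I' N k) : FormField I M k := fun x =>
  (α (f x)).compContinuousLinearMap (mfderiv I I' f x)

/-! ### Basic facts, needed for the definitions below -/

theorem two_le_infty : (2 : ℕ∞ω) ≤ ∞ := by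
  change ((2 : ℕ∞) : ℕ∞ω) ≤ ((⊤ : ℕ∞) : ℕ∞ω)
  exact WithTop.coe_le_coe.2 le_top

theorem chartRep_comp_mfderiv [IsManifold I ∞ M] {k : ℕ} (α : FormField I M k) (x₀ : M) {q : M}
    (hq : q ∈ (extChartAt I x₀).source) :
    (chartRep α x₀ (extChartAt I x₀ q)).compContinuousLinearMap
      (mfderiv I 𝓘(ℝ, E) (extChartAt I x₀) q) = α q := by
  have : IsManifold I 1 M := IsManifold.of_le (n := ∞) (by norm_cast)
  have h1 := mfderivWithin_extChartAt_symm_comp_mfderiv_extChartAt' (I := I) hq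
  ext v
  have h2 : ∀ i, mfderivWithin 𝓘(ℝ, E) I (extChartAt I x₀).symm (Set.range I)
      (extChartAt I x₀ q) (mfderiv I 𝓘(ℝ, E) (extChartAt I x₀) q (v i)) = v i := fun i =>
    DFunLike.congr_fun h1 (v i)
  have h3 : ∀ q' : M, q' = q → ∀ w : Fin k → E,
      (show E [⋀^Fin k]→L[ℝ] ℝ from α q') w = (show E [⋀^Fin k]→L[ℝ] ℝ from α q) w := by
    rintro _ rfl w; rfl
  refine (h3 _ ((extChartAt I x₀).left_inv hq) _).trans ?_
  exact congrArg (show E [⋀^Fin k]→L[ℝ] ℝ from α q) (funext h2)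

theorem fderivWithin_chartExpr [IsManifold I ∞ M] [IsManifold I' ∞ N] {f : M → N}
    (hf : ContMDiff I I' ∞ f) (x₀ : M) (x₁ : N) {y : E}
    (hy : y ∈ (extChartAt I x₀).target)
    (hy' : f ((extChartAt I x₀).symm y) ∈ (extChartAt I' x₁).source) :
    fderivWithin ℝ (extChartAt I' x₁ ∘ f ∘ (extChartAt I x₀).symm) (Set.range I) y =
      (mfderiv I' 𝓘(ℝ, E') (extChartAt I' x₁) (f ((extChartAt I x₀).symm y))).comp
        ((mfderiv I I' f ((extChartAt I x₀).symm y)).comp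
          (mfderivWithin 𝓘(ℝ, E) I (extChartAt I x₀).symm (Set.range I) y)) := by
  have : IsManifold I 1 M := IsManifold.of_le (n := ∞) (by norm_cast)
  have : IsManifold I' 1 N := IsManifold.of_le (n := ∞) (by norm_cast)
  have hyr : y ∈ Set.range I := extChartAt_target_subset_range x₀ hy
  have hu : UniqueMDiffWithinAt 𝓘(ℝ, E) (Set.range I) y := I.uniqueMDiffOn y hyr
  have h1 : MDifferentiableWithinAt 𝓘(ℝ, E) I (extChartAt I x₀).symm (Set.range I) y :=
    mdifferentiableWithinAt_extChartAt_symm hy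
  have h2 : MDifferentiableAt I I' f ((extChartAt I x₀).symm y) :=
    hf.mdifferentiable (by simp) _
  have h3 : MDifferentiableAt I' 𝓘(ℝ, E') (extChartAt I' x₁) (f ((extChartAt I x₀).symm y)) :=
    mdifferentiableAt_extChartAt (by rwa [← extChartAt_source (I := I')])
  rw [← mfderivWithin_eq_fderivWithin,
    mfderiv_comp_mfderivWithin (I' := I') y h3 (h2.comp_mdifferentiableWithinAt y h1) hu,
    mfderiv_comp_mfderivWithin (I' := I) y h2 h1 hu]
  rfl

theorem chartRep_pullbackField [IsManifold I ∞ M] [IsManifold I' ∞ N] {k : ℕ} {f : M → N}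
    (hf : ContMDiff I I' ∞ f) (α : FormField I' N k) (x₀ : M) (x₁ : N) {y : E}
    (hy : y ∈ (extChartAt I x₀).target)
    (hy' : f ((extChartAt I x₀).symm y) ∈ (extChartAt I' x₁).source) :
    chartRep (pullbackField (I := I) f α) x₀ y =
      (chartRep α x₁ ((extChartAt I' x₁ ∘ f ∘ (extChartAt I x₀).symm) y)).compContinuousLinearMap
        (fderivWithin ℝ (extChartAt I' x₁ ∘ f ∘ (extChartAt I x₀).symm) (Set.range I) y) := by
  rw [fderivWithin_chartExpr hf x₀ x₁ hy hy']
  unfold chartRep pullbackField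
  rw [← chartRep_comp_mfderiv α x₁ hy']
  rfl

theorem eventually_mem_charts {f : M → N} (hf : Continuous f) (x₀ : M) (x₁ : N) {y : E}
    (hy : y ∈ (extChartAt I x₀).target)
    (hy' : f ((extChartAt I x₀).symm y) ∈ (extChartAt I' x₁).source) :
    ∀ᶠ z in 𝓝[Set.range I] y, z ∈ (extChartAt I x₀).target ∧
      f ((extChartAt I x₀).symm z) ∈ (extChartAt I' x₁).source := by
  have h1 := extChartAt_target_mem_nhdsWithin_of_mem hy
  have h2 : ContinuousWithinAt (fun z => f ((extChartAt I x₀).symm z)) (Set.range I) y :=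
    hf.continuousAt.comp_continuousWithinAt
      ((continuousOn_extChartAt_symm x₀ y hy).mono_of_mem_nhdsWithin h1)
  exact Filter.Eventually.and h1
    (h2.eventually ((isOpen_extChartAt_source x₁).mem_nhds hy'))

theorem contDiffWithinAt_chartExpr [IsManifold I ∞ M] [IsManifold I' ∞ N] {f : M → N}
    (hf : ContMDiff I I' ∞ f) (x₀ : M) (x₁ : N) {y : E}
    (hy : y ∈ (extChartAt I x₀).target)
    (hy' : f ((extChartAt I x₀).symm y) ∈ (extChartAt I' x₁).source) :
    ContDiffWithinAt ℝ ∞ (extChartAt I' x₁ ∘ f ∘ (extChartAt I x₀).symm) (Set.range I) y := by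
  have h := ((contMDiffAt_iff_of_mem_source (I := I) (I' := I') (n := ∞) (x := x₀) (y := x₁)
    (x' := (extChartAt I x₀).symm y)
    (by rw [← extChartAt_source (I := I)]; exact (extChartAt I x₀).map_target hy)
    (by rwa [← extChartAt_source (I := I')])).1 (hf _)).2
  rwa [(extChartAt I x₀).right_inv hy] at h

theorem smoothForms.contDiffWithinAt {k : ℕ} {α : FormField I M k} (hα : α ∈ smoothForms I M k) (x₀ : M) {y : E}
    (hy : y ∈ (extChartAt I x₀).target) :
    ContDiffWithinAt ℝ ∞ (chartRep α x₀) (Set.range I) y :=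
  (hα x₀ y hy).mono_of_mem_nhdsWithin (extChartAt_target_mem_nhdsWithin_of_mem hy)

theorem contDiff_compContinuousLinearMap {k : ℕ} [FiniteDimensional ℝ E] :
    ContDiff ℝ ∞ (fun p : (E' [⋀^Fin k]→L[ℝ] ℝ) × (E →L[ℝ] E') =>
      p.1.compContinuousLinearMap p.2) := by
  let T : (E [⋀^Fin k]→L[ℝ] ℝ) →L[ℝ] ContinuousMultilinearMap ℝ (fun _ : Fin k => E) ℝ :=
    ContinuousAlternatingMap.toContinuousMultilinearMapCLM ℝ
  have hfin : FiniteDimensional ℝ (ContinuousMultilinearMap ℝ (fun _ : Fin k => E) ℝ) :=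
    Module.Finite.of_injective
      (ContinuousMultilinearMap.toMultilinearMapLinear :
        ContinuousMultilinearMap ℝ (fun _ : Fin k => E) ℝ →ₗ[ℝ] _)
      ContinuousMultilinearMap.toMultilinearMap_injective
  have hT : T.HasLeftInverse := .of_injective_of_finiteDimensional
    ContinuousAlternatingMap.toContinuousMultilinearMap_injective
  obtain ⟨L, hL⟩ := hT
  have h1 : ContDiff ℝ ∞ (fun p : (E' [⋀^Fin k]→L[ℝ] ℝ) × (E →L[ℝ] E') =>
      (ContinuousMultilinearMap.compContinuousLinearMapContinuousMultilinear ℝ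
        (fun _ : Fin k => E) (fun _ => E') ℝ (fun _ => p.2))
          (ContinuousAlternatingMap.toContinuousMultilinearMapCLM ℝ p.1)) := by
    refine ContDiff.clm_apply ?_ ?_
    · exact (ContinuousMultilinearMap.contDiff _).comp (contDiff_pi.2 fun _ => contDiff_snd)
    · exact (ContinuousLinearMap.contDiff _).comp contDiff_fst
  have h2 := L.contDiff.comp h1
  have h3 : (fun p : (E' [⋀^Fin k]→L[ℝ] ℝ) × (E →L[ℝ] E') => p.1.compContinuousLinearMap p.2) =
      _ := funext fun p => (hL (p.1.compContinuousLinearMap p.2)).symm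
  rw [h3]
  exact h2

theorem pullbackField_mem [FiniteDimensional ℝ E] [IsManifold I ∞ M] [IsManifold I' ∞ N] {k : ℕ}
    {f : M → N} (hf : ContMDiff I I' ∞ f) {α : FormField I' N k} (hα : α ∈ smoothForms I' N k) :
    pullbackField f α ∈ smoothForms I M k := by
  intro x₀ y hy
  set x₁ := f ((extChartAt I x₀).symm y) with hx₁
  have hy' : f ((extChartAt I x₀).symm y) ∈ (extChartAt I' x₁).source := mem_extChartAt_source _
  have hyr : y ∈ Set.range I := extChartAt_target_subset_range x₀ hy
  have hg := contDiffWithinAt_chartExpr hf x₀ x₁ hy hy'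
  have h1 : ContDiffWithinAt ℝ ∞ (fun z =>
      chartRep α x₁ ((extChartAt I' x₁ ∘ f ∘ (extChartAt I x₀).symm) z)) (Set.range I) y := by
    refine (smoothForms.contDiffWithinAt hα x₁ ((extChartAt I' x₁).map_source hy')).comp y hg ?_
    intro z _
    simp [extChartAt]
  have h2 := hg.fderivWithin_right (m := ∞) I.uniqueDiffOn (by simp) hyr
  have h3 := contDiff_compContinuousLinearMap.contDiffAt.comp_contDiffWithinAt y (h1.prodMk h2)
  refine (h3.congr_of_eventuallyEq_of_mem ?_ hyr).mono (extChartAt_target_subset_range x₀)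
  filter_upwards [eventually_mem_charts hf.continuous x₀ x₁ hy hy'] with z hz
  exact chartRep_pullbackField hf α x₀ x₁ hz.1 hz.2

theorem extDerivWithin_chartRep_pullbackField [IsManifold I ∞ M] [IsManifold I' ∞ N] {k : ℕ}
    {f : M → N} (hf : ContMDiff I I' ∞ f) {α : FormField I' N k} (hα : α ∈ smoothForms I' N k)
    (x₀ : M) (x₁ : N) {y : E} (hy : y ∈ (extChartAt I x₀).target)
    (hy' : f ((extChartAt I x₀).symm y) ∈ (extChartAt I' x₁).source) :
    extDerivWithin (chartRep (pullbackField (I := I) f α) x₀) (Set.range I) y =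
      (extDerivWithin (chartRep α x₁) (Set.range I')
        ((extChartAt I' x₁ ∘ f ∘ (extChartAt I x₀).symm) y)).compContinuousLinearMap
        (fderivWithin ℝ (extChartAt I' x₁ ∘ f ∘ (extChartAt I x₀).symm) (Set.range I) y) := by
  have hyr : y ∈ Set.range I := extChartAt_target_subset_range x₀ hy
  have hg := contDiffWithinAt_chartExpr hf x₀ x₁ hy hy'
  have hd := (smoothForms.contDiffWithinAt hα x₁
    ((extChartAt I' x₁).map_source hy')).differentiableWithinAt (by simp)
  have h := extDerivWithin_pullback (r := ∞) (t := Set.range I')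
    (f := extChartAt I' x₁ ∘ f ∘ (extChartAt I x₀).symm) hd hg
    (by simp [two_le_infty]) I.uniqueDiffOn
    (I.range_subset_closure_interior hyr) hyr (fun z _ => by simp [extChartAt])
  rw [← h]
  refine Filter.EventuallyEq.extDerivWithin_eq_of_mem ?_ hyr
  filter_upwards [eventually_mem_charts hf.continuous x₀ x₁ hy hy'] with z hz
  exact chartRep_pullbackField hf α x₀ x₁ hz.1 hz.2

theorem pullbackField_id {k : ℕ} (α : FormField I M k) : pullbackField (I := I) id α = α := by
  funext x
  unfold pullbackField
  rw [mfderiv_id]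
  rfl

/-- In every preferred chart, the exterior derivative of a smooth form is given by the exterior
derivative on the model vector space. -/
theorem chartRep_extDerivField [IsManifold I ∞ M] {k : ℕ} {α : FormField I M k}
    (hα : α ∈ smoothForms I M k) (x₀ : M) {y : E} (hy : y ∈ (extChartAt I x₀).target) :
    chartRep (extDerivField α) x₀ y = extDerivWithin (chartRep α x₀) (Set.range I) y := by
  have hs : id ((extChartAt I x₀).symm y) ∈ (extChartAt I ((extChartAt I x₀).symm y)).source :=
    mem_extChartAt_source _
  have h := extDerivWithin_chartRep_pullbackField (contMDiff_id (I := I) (M := M) (n := ∞)) hα x₀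
    ((extChartAt I x₀).symm y) hy hs
  rw [pullbackField_id] at h
  rw [h, fderivWithin_chartExpr contMDiff_id x₀ _ hy hs, mfderiv_id]
  rfl

theorem extDerivField_mem [IsManifold I ∞ M] {k : ℕ} {α : FormField I M k}
    (hα : α ∈ smoothForms I M k) : extDerivField α ∈ smoothForms I M (k + 1) := by
  intro x₀ y hy
  have hyr : y ∈ Set.range I := extChartAt_target_subset_range x₀ hy
  have h1 := (smoothForms.contDiffWithinAt hα x₀ hy).fderivWithin_right (m := ∞) I.uniqueDiffOn
    (by simp) hyr
  have h2 : ContDiffWithinAt ℝ ∞ (extDerivWithin (chartRep α x₀) (Set.range I)) (Set.range I) y :=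
    ContDiffAt.comp_contDiffWithinAt
      (g := ContinuousAlternatingMap.alternatizeUncurryFinCLM (n := k) ℝ E ℝ) y
      (ContinuousLinearMap.contDiff _).contDiffAt h1
  refine (h2.mono (extChartAt_target_subset_range x₀)).congr (fun z hz => ?_) ?_
  · exact chartRep_extDerivField hα x₀ hz
  · exact chartRep_extDerivField hα x₀ hy

theorem extDerivField_extDerivField [IsManifold I ∞ M] {k : ℕ} {α : FormField I M k}
    (hα : α ∈ smoothForms I M k) : extDerivField (extDerivField α) = 0 := by
  funext x
  have hy := mem_extChartAt_target (I := I) x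
  have hyr : extChartAt I x x ∈ Set.range I := extChartAt_target_subset_range x hy
  have h : extDerivWithin (chartRep (extDerivField α) x) (Set.range I) (extChartAt I x x) = 0 := by
    rw [← extDerivWithin_extDerivWithin_apply (smoothForms.contDiffWithinAt hα x hy) (by simp [two_le_infty])
      I.uniqueDiffOn (I.range_subset_closure_interior hyr) hyr]
    refine Filter.EventuallyEq.extDerivWithin_eq_of_mem ?_ hyr
    filter_upwards [extChartAt_target_mem_nhdsWithin_of_mem hy] with z hz
    exact chartRep_extDerivField hα x hz
  unfold extDerivField at h ⊢
  rw [h]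
  rfl

theorem extDerivField_pullbackField [IsManifold I ∞ M] [IsManifold I' ∞ N] {k : ℕ}
    {f : M → N} (hf : ContMDiff I I' ∞ f) {α : FormField I' N k} (hα : α ∈ smoothForms I' N k) :
    extDerivField (pullbackField (I := I) f α) = pullbackField f (extDerivField α) := by
  funext x
  have : IsManifold I 1 M := IsManifold.of_le (n := ∞) (by norm_cast)
  have hx := (extChartAt I x).left_inv (mem_extChartAt_source x)
  have hy := mem_extChartAt_target (I := I) x
  have hs : f ((extChartAt I x).symm (extChartAt I x x)) ∈ (extChartAt I' (f x)).source := by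
    rw [hx]
    exact mem_extChartAt_source _
  have h := extDerivWithin_chartRep_pullbackField (I := I) hf hα x (f x) hy hs
  have hfd := fderivWithin_chartExpr (I := I) (I' := I') hf x (f x) hy hs
  have hinv := mfderivWithin_extChartAt_symm_comp_mfderiv_extChartAt' (I := I)
    (mem_extChartAt_source (I := I) x)
  let F : M → E →L[ℝ] E' := fun p =>
    (mfderiv I' 𝓘(ℝ, E') (extChartAt I' (f x)) (f p)).comp (mfderiv I I' f p)
  have hF : F ((extChartAt I x).symm (extChartAt I x x)) = F x := congrArg F hx
  have hfx : (extChartAt I' (f x) ∘ f ∘ (extChartAt I x).symm) (extChartAt I x x) =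
      extChartAt I' (f x) (f x) := by
    simp only [Function.comp_apply, hx]
  have hcomp : ∀ v : TangentSpace I x,
      fderivWithin ℝ (extChartAt I' (f x) ∘ f ∘ (extChartAt I x).symm) (Set.range I)
        (extChartAt I x x) (mfderiv I 𝓘(ℝ, E) (extChartAt I x) x v) = F x v := by
    intro v
    rw [hfd, ← hF]
    exact congrArg (F ((extChartAt I x).symm (extChartAt I x x))) (DFunLike.congr_fun hinv v)
  unfold extDerivField
  rw [h, hfx]
  ext v
  exact congrArg (extDerivWithin (chartRep α (f x)) (Set.range I') (extChartAt I' (f x) (f x)))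
    (funext fun i => hcomp (v i))

theorem extDerivField_add {k : ℕ} {α β : FormField I M k}
    (hα : α ∈ smoothForms I M k) (hβ : β ∈ smoothForms I M k) :
    extDerivField (α + β) = extDerivField α + extDerivField β := by
  funext x
  have hy := mem_extChartAt_target (I := I) x
  have h := extDerivWithin_add (I.uniqueDiffOn _ (extChartAt_target_subset_range x hy))
    ((smoothForms.contDiffWithinAt hα x hy).differentiableWithinAt (by simp))
    ((smoothForms.contDiffWithinAt hβ x hy).differentiableWithinAt (by simp))
  unfold extDerivField
  rw [chartRep_add, h]
  rfl

theorem extDerivField_smul {k : ℕ} (c : ℝ) (α : FormField I M k) :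
    extDerivField (c • α) = c • extDerivField α := by
  funext x
  have hy := mem_extChartAt_target (I := I) x
  have h := extDerivWithin_smul c (chartRep α x)
    (I.uniqueDiffOn _ (extChartAt_target_subset_range x hy))
  unfold extDerivField
  rw [chartRep_smul, h]
  rfl

end Forms

section Complex

variable {E : Type*} [NormedAddCommGroup E] [NormedSpace ℝ E]
  {H : Type*} [TopologicalSpace H] (I : ModelWithCorners ℝ E H)
  (M : Type*) [TopologicalSpace M] [ChartedSpace H M]

/-- `Ω^k(M)`: the real vector space of smooth differential `k`-forms on `M`. -/
def Form (k : ℕ) : Type _ := smoothForms I M k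

instance (k : ℕ) : AddCommGroup (Form I M k) := inferInstanceAs (AddCommGroup (smoothForms I M k))

instance (k : ℕ) : Module ℝ (Form I M k) := inferInstanceAs (Module ℝ (smoothForms I M k))

variable [IsManifold I ∞ M]

/-- The exterior derivative `d : Ω^k(M) → Ω^{k+1}(M)`. -/
def d (k : ℕ) : Form I M k →ₗ[ℝ] Form I M (k + 1) where
  toFun α := ⟨extDerivField α.1, extDerivField_mem α.2⟩
  map_add' α β := Subtype.ext (extDerivField_add α.2 β.2)
  map_smul' c α := Subtype.ext (extDerivField_smul c α.1)

/-- The de Rham complex is a complex. -/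
theorem d_d (k : ℕ) (α : Form I M k) : d I M (k + 1) (d I M k α) = 0 :=
  Subtype.ext (extDerivField_extDerivField α.2)

/-- `Z^k(M)`: the closed `k`-forms. -/
def closedForms (k : ℕ) : Submodule ℝ (Form I M k) := LinearMap.ker (d I M k)

/-- `B^k(M)`: the exact `k`-forms, with `B^0(M) = 0`. -/
def exactForms : (k : ℕ) → Submodule ℝ (Form I M k)
  | 0 => ⊥
  | k + 1 => LinearMap.range (d I M k)

theorem exactForms_le_closedForms (k : ℕ) : exactForms I M k ≤ closedForms I M k := by
  cases k with
  | zero => exact bot_le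
  | succ k =>
    rintro _ ⟨α, rfl⟩
    exact d_d I M k α

/-- The de Rham cohomology `H^k(M) = Z^k(M) / B^k(M)`. -/
abbrev Cohomology (k : ℕ) : Type _ :=
  closedForms I M k ⧸ (exactForms I M k).submoduleOf (closedForms I M k)

variable {I M}

/-- The cohomology class `[α]` of a closed form `α`. -/
def cohomologyClass {k : ℕ} : closedForms I M k →ₗ[ℝ] Cohomology I M k :=
  Submodule.mkQ _

theorem cohomologyClass_eq_iff {k : ℕ} (α β : closedForms I M k) :
    cohomologyClass α = cohomologyClass β ↔ (α : Form I M k) - β ∈ exactForms I M k :=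
  Submodule.Quotient.eq _

variable [FiniteDimensional ℝ E]
  {E' : Type*} [NormedAddCommGroup E'] [NormedSpace ℝ E']
  {H' : Type*} [TopologicalSpace H'] {I' : ModelWithCorners ℝ E' H'}
  {N : Type*} [TopologicalSpace N] [ChartedSpace H' N] [IsManifold I' ∞ N]

/-- The pullback `f^* : Ω^k(N) → Ω^k(M)` along a smooth map `f : M → N`. -/
def pullback (f : C^∞⟮I, M; I', N⟯) (k : ℕ) : Form I' N k →ₗ[ℝ] Form I M k where
  toFun α := ⟨pullbackField f α.1, pullbackField_mem f.contMDiff α.2⟩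
  map_add' _ _ := rfl
  map_smul' _ _ := rfl

theorem d_pullback (f : C^∞⟮I, M; I', N⟯) (k : ℕ) (α : Form I' N k) :
    d I M k (pullback f k α) = pullback f (k + 1) (d I' N k α) :=
  Subtype.ext (extDerivField_pullbackField f.contMDiff α.2)

/-- The pullback of closed forms. -/
def pullbackClosed (f : C^∞⟮I, M; I', N⟯) (k : ℕ) : closedForms I' N k →ₗ[ℝ] closedForms I M k :=
  (pullback f k).restrict fun α hα => by
    have hα' : d I' N k α = 0 := hα
    change d I M k (pullback f k α) = 0
    rw [d_pullback, hα', map_zero]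

theorem pullback_mem_exactForms (f : C^∞⟮I, M; I', N⟯) (k : ℕ) {α : Form I' N k}
    (hα : α ∈ exactForms I' N k) : pullback f k α ∈ exactForms I M k := by
  cases k with
  | zero =>
    have hα' : α = 0 := hα
    rw [hα', map_zero]
    exact Submodule.zero_mem _
  | succ k =>
    obtain ⟨β, rfl⟩ := hα
    exact ⟨pullback f k β, d_pullback f k β⟩

/-- The map `H^k(N) → H^k(M)`, `[α] ↦ [f^* α]`, induced by a smooth map `f : M → N`. -/
def cohomologyPullback (f : C^∞⟮I, M; I', N⟯) (k : ℕ) :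
    Cohomology I' N k →ₗ[ℝ] Cohomology I M k :=
  Submodule.mapQ _ _ (pullbackClosed f k) fun _ hα => pullback_mem_exactForms f k hα

theorem cohomologyPullback_cohomologyClass (f : C^∞⟮I, M; I', N⟯) (k : ℕ)
    (α : closedForms I' N k) :
    cohomologyPullback f k (cohomologyClass α) = cohomologyClass (pullbackClosed f k α) := rfl

end Complex

section MayerVietoris

variable {E : Type*} [NormedAddCommGroup E] [NormedSpace ℝ E]
  {H : Type*} [TopologicalSpace H] (I : ModelWithCorners ℝ E H)
  {M : Type*} [TopologicalSpace M] [ChartedSpace H M]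

/-- The inclusion of an open subset `U`, itself regarded as a manifold, into `M`. -/
def inclM (U : Opens M) : C^∞⟮I, U; I, M⟯ := ⟨Subtype.val, contMDiff_subtype_val⟩

/-- The inclusion `U → V` of open subsets of `M`, both regarded as manifolds. -/
def incl {U V : Opens M} (h : U ≤ V) : C^∞⟮I, U; I, V⟯ :=
  ⟨Opens.inclusion h, contMDiff_inclusion h⟩

variable [FiniteDimensional ℝ E] [IsManifold I ∞ M] (U V : Opens M) (k : ℕ)

/-- `i : Ω^k(M) → Ω^k(U) ⊕ Ω^k(V)`, `i(α) = (α|_U, α|_V)`. -/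
def mvI : Form I M k →ₗ[ℝ] Form I U k × Form I V k :=
  (pullback (inclM I U) k).prod (pullback (inclM I V) k)

/-- `j : Ω^k(U) ⊕ Ω^k(V) → Ω^k(U ∩ V)`, `j(α, β) = α|_{U ∩ V} - β|_{U ∩ V}`. -/
def mvJ : Form I U k × Form I V k →ₗ[ℝ] Form I (U ⊓ V : Opens M) k :=
  pullback (incl I inf_le_left) k ∘ₗ LinearMap.fst ℝ _ _ -
    pullback (incl I inf_le_right) k ∘ₗ LinearMap.snd ℝ _ _

/-- The differential of the complex `Ω^*(U) ⊕ Ω^*(V)`. -/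
def mvD : Form I U k × Form I V k →ₗ[ℝ] Form I U (k + 1) × Form I V (k + 1) :=
  (d I U k).prodMap (d I V k)

/-- `i^* : H^k(M) → H^k(U) ⊕ H^k(V)`, `i^*[α] = ([α|_U], [α|_V])`. -/
def mvIStar : Cohomology I M k →ₗ[ℝ] Cohomology I U k × Cohomology I V k :=
  (cohomologyPullback (inclM I U) k).prod (cohomologyPullback (inclM I V) k)

/-- `j^* : H^k(U) ⊕ H^k(V) → H^k(U ∩ V)`, `j^*([α], [β]) = [α|_{U ∩ V}] - [β|_{U ∩ V}]`. -/
def mvJStar :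
    Cohomology I U k × Cohomology I V k →ₗ[ℝ] Cohomology I (U ⊓ V : Opens M) k :=
  cohomologyPullback (incl I inf_le_left) k ∘ₗ LinearMap.fst ℝ _ _ -
    cohomologyPullback (incl I inf_le_right) k ∘ₗ LinearMap.snd ℝ _ _

end MayerVietoris

end DeRham

end

/-!
The sequence of complexes is exact because forms are sections of a fine sheaf. The inclusion of an
open subset reads as the identity in the preferred charts (`DeRham.IsChartInclusion`), so that
restriction of forms is restriction of functions and smoothness at a point can be tested on any
open neighbourhood of it. Hence forms on `U` and `V` that agree on `U ∩ V` glue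
(`DeRham.exists_mvI_eq`). Surjectivity of `j` (`DeRham.mvJ_surjective`) comes from a smooth function
`ρ` on `M` that is `0` near `M \ U` and `1` near `M \ V`: a form `σ` on `U ∩ V` is the difference
of `(1 - ρ) σ`, extended by zero to `U`, and `-ρ σ`, extended by zero to `V`.

The long exact sequence follows from the short exact one by diagram chases. The degrees `0` and
`k + 1`, in which exact forms are defined differently, are treated at once through
`DeRham.exists_exact_mvJ_eq`: every exact form on `U ∩ V` is `j` of a pair of exact forms. A linear
section of `j` and a linear retraction of `i`, which exist over the field `ℝ`, make the connecting
homomorphism linear (`DeRham.exists_connecting`).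
-/

noncomputable section

namespace DeRham

/-! ### Smoothness at a point and restriction to open subsets -/

section Local

variable {E : Type*} [NormedAddCommGroup E] [NormedSpace ℝ E]
  {H : Type*} [TopologicalSpace H] {I : ModelWithCorners ℝ E H}
  {M : Type*} [TopologicalSpace M] [ChartedSpace H M]
  {N : Type*} [TopologicalSpace N] [ChartedSpace H N]

theorem Form.ext {k : ℕ} {α β : Form I M k} (h : ∀ x, α.1 x = β.1 x) : α = β :=
  Subtype.ext (funext h)

/-- Smoothness of a field of alternating forms at the point `x`, tested in the preferred chart
at `x`. -/
def SmoothFormAt {k : ℕ} (α : FormField I M k) (x : M) : Prop :=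
  ContDiffWithinAt ℝ ∞ (chartRep α x) (Set.range I) (extChartAt I x x)

theorem smoothFormAt_of_mem {k : ℕ} {α : FormField I M k} (hα : α ∈ smoothForms I M k) (x : M) :
    SmoothFormAt α x :=
  smoothForms.contDiffWithinAt hα x (mem_extChartAt_target x)

/-- A field that is smooth at every point is smooth in every preferred chart: the change of charts
is the pullback along the identity. -/
theorem mem_smoothForms_of_smoothFormAt [FiniteDimensional ℝ E] [IsManifold I ∞ M] {k : ℕ}
    {α : FormField I M k} (hα : ∀ x, SmoothFormAt α x) : α ∈ smoothForms I M k := by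
  intro x₀ y hy
  set x₁ := (extChartAt I x₀).symm y with hx₁
  have hy' : id ((extChartAt I x₀).symm y) ∈ (extChartAt I x₁).source := mem_extChartAt_source _
  have hyr : y ∈ Set.range I := extChartAt_target_subset_range x₀ hy
  have hid := contMDiff_id (I := I) (M := M) (n := ∞)
  have hg := contDiffWithinAt_chartExpr hid x₀ x₁ hy hy'
  have h1 : ContDiffWithinAt ℝ ∞ (fun z =>
      chartRep α x₁ ((extChartAt I x₁ ∘ id ∘ (extChartAt I x₀).symm) z)) (Set.range I) y := by
    have hα₁ : ContDiffWithinAt ℝ ∞ (chartRep α x₁) (Set.range I)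
        ((extChartAt I x₁ ∘ id ∘ (extChartAt I x₀).symm) y) := hα x₁
    refine hα₁.comp y hg ?_
    intro z _
    simp [extChartAt]
  have h2 := hg.fderivWithin_right (m := ∞) I.uniqueDiffOn (by simp) hyr
  have h3 := contDiff_compContinuousLinearMap.contDiffAt.comp_contDiffWithinAt y (h1.prodMk h2)
  refine (h3.congr_of_eventuallyEq_of_mem ?_ hyr).mono (extChartAt_target_subset_range x₀)
  filter_upwards [eventually_mem_charts continuous_id x₀ x₁ hy hy'] with z hz
  have h := chartRep_pullbackField hid α x₀ x₁ hz.1 hz.2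
  rwa [pullbackField_id] at h

theorem tendsto_extChartAt_symm (x : M) :
    Filter.Tendsto (extChartAt I x).symm (𝓝[Set.range I] (extChartAt I x x)) (𝓝 x) := by
  have h := (continuousAt_extChartAt_symm (I := I) x).continuousWithinAt (s := Set.range I)
  rwa [ContinuousWithinAt, extChartAt_to_inv] at h

theorem SmoothFormAt.congr {k : ℕ} {α β : FormField I M k} {x : M} (hα : SmoothFormAt α x)
    (h : ∀ᶠ z in 𝓝 x, β z = α z) : SmoothFormAt β x := by
  refine ContDiffWithinAt.congr_of_eventuallyEq_of_mem hα ?_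
    (extChartAt_target_subset_range x (mem_extChartAt_target x))
  filter_upwards [(tendsto_extChartAt_symm x).eventually h] with y hy
  unfold chartRep
  rw [hy]

theorem SmoothFormAt.zero {k : ℕ} (x : M) : SmoothFormAt (0 : FormField I M k) x :=
  smoothFormAt_of_mem (Submodule.zero_mem _) x

theorem SmoothFormAt.smul {k : ℕ} {ρ : M → ℝ} {α : FormField I M k} {x : M}
    (hρ : ContMDiffAt I 𝓘(ℝ) ∞ ρ x) (hα : SmoothFormAt α x) :
    SmoothFormAt (fun z => ρ z • α z : FormField I M k) x := by
  have h := (contMDiffAt_iff.1 hρ).2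
  rw [extChartAt_model_space_eq_id] at h
  exact ContDiffWithinAt.smul (f := fun y => ρ ((extChartAt I x).symm y)) h hα

/-- A smooth map `f` that reads as the identity in the preferred charts at `x` and `f x`, for every
`x`. The inclusions of open subsets are of this kind. The equation is required also for `z` outside
the chart domain: there the chart of an open subset still is the composition of the inclusion with
the chart of the ambient space. -/
def IsChartInclusion (I : ModelWithCorners ℝ E H) (f : M → N) : Prop :=
  ContMDiff I I ∞ f ∧ ∀ x z, extChartAt I (f x) (f z) = extChartAt I x z

theorem isChartInclusion_inclM (U : Opens M) : IsChartInclusion I (inclM I U) :=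
  ⟨(inclM I U).contMDiff, fun _ _ => rfl⟩

theorem isChartInclusion_incl {U V : Opens M} (h : U ≤ V) : IsChartInclusion I (incl I h) :=
  ⟨(incl I h).contMDiff, fun _ _ => rfl⟩

namespace IsChartInclusion

variable {f : M → N}

theorem eqOn_target (hf : IsChartInclusion I f) (x : M) :
    Set.EqOn (extChartAt I (f x) ∘ f ∘ (extChartAt I x).symm) id (extChartAt I x).target :=
  fun _ hy => (hf.2 x _).trans ((extChartAt I x).right_inv hy)

theorem fderivWithin_eq (hf : IsChartInclusion I f) (x : M) {y : E}
    (hy : y ∈ (extChartAt I x).target) :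
    fderivWithin ℝ (extChartAt I (f x) ∘ f ∘ (extChartAt I x).symm) (Set.range I) y =
      ContinuousLinearMap.id ℝ E := by
  have hyr := extChartAt_target_subset_range x hy
  rw [Filter.EventuallyEq.fderivWithin_eq_of_mem (f := id) ?_ hyr,
    fderivWithin_id (I.uniqueDiffOn y hyr)]
  filter_upwards [extChartAt_target_mem_nhdsWithin_of_mem hy] with z hz
  exact hf.eqOn_target x hz

theorem mfderiv_eq (hf : IsChartInclusion I f) (x : M) :
    mfderiv I I f x = ContinuousLinearMap.id ℝ E := by
  refine (if_pos (hf.1.mdifferentiable (by simp) x)).trans ?_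
  exact hf.fderivWithin_eq x (mem_extChartAt_target x)

theorem pullbackField_apply (hf : IsChartInclusion I f) {k : ℕ} (α : FormField I N k) (x : M) :
    pullbackField (I := I) f α x = (α (f x) : E [⋀^Fin k]→L[ℝ] ℝ) := by
  unfold pullbackField
  rw [hf.mfderiv_eq]
  rfl

theorem chartRep_eventuallyEq [IsManifold I ∞ M] [IsManifold I ∞ N] (hf : IsChartInclusion I f)
    {k : ℕ} (α : FormField I N k) (x : M) :
    chartRep (pullbackField (I := I) f α) x =ᶠ[𝓝[Set.range I] (extChartAt I x x)]
      chartRep α (f x) := by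
  have hs : f ((extChartAt I x).symm (extChartAt I x x)) ∈ (extChartAt I (f x)).source := by
    rw [extChartAt_to_inv]
    exact mem_extChartAt_source _
  filter_upwards [eventually_mem_charts hf.1.continuous x (f x) (mem_extChartAt_target x) hs]
    with y hy
  rw [chartRep_pullbackField hf.1 α x (f x) hy.1 hy.2, hf.fderivWithin_eq x hy.1,
    hf.eqOn_target x hy.1]
  rfl

theorem smoothFormAt_pullbackField_iff [IsManifold I ∞ M] [IsManifold I ∞ N]
    (hf : IsChartInclusion I f) {k : ℕ} (α : FormField I N k) (x : M) :
    SmoothFormAt (pullbackField (I := I) f α) x ↔ SmoothFormAt α (f x) := by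
  unfold SmoothFormAt
  rw [hf.2 x x]
  have hx := extChartAt_target_subset_range (I := I) x (mem_extChartAt_target x)
  have h := hf.chartRep_eventuallyEq α x
  exact ⟨fun h' => h'.congr_of_eventuallyEq_of_mem h.symm hx,
    fun h' => h'.congr_of_eventuallyEq_of_mem h hx⟩

end IsChartInclusion

end Local

/-! ### The short exact sequence of complexes -/

section ShortExact

variable {E : Type*} [NormedAddCommGroup E] [NormedSpace ℝ E] [FiniteDimensional ℝ E]
  {H : Type*} [TopologicalSpace H] {I : ModelWithCorners ℝ E H}
  {M : Type*} [TopologicalSpace M] [ChartedSpace H M] [IsManifold I ∞ M]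

/-- Restriction of forms is restriction of functions, since the inclusion reads as the identity in
the charts. -/
theorem pullback_inclM_apply (U : Opens M) {k : ℕ} (α : Form I M k) (x : U) :
    (pullback (inclM I U) k α).1 x = (α.1 x.1 : E [⋀^Fin k]→L[ℝ] ℝ) :=
  (isChartInclusion_inclM U).pullbackField_apply α.1 x

theorem pullback_incl_apply {U V : Opens M} (h : U ≤ V) {k : ℕ} (α : Form I V k) (x : U) :
    (pullback (incl I h) k α).1 x =
      (α.1 (Opens.inclusion h x) : E [⋀^Fin k]→L[ℝ] ℝ) :=
  (isChartInclusion_incl h).pullbackField_apply α.1 x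

theorem mvJ_eq_zero_iff (U V : Opens M) {k : ℕ} (β : Form I U k × Form I V k) :
    mvJ I U V k β = 0 ↔
      pullback (incl I inf_le_left) k β.1 =
        pullback (incl I (inf_le_right : U ⊓ V ≤ V)) k β.2 :=
  sub_eq_zero

theorem mvI_d (U V : Opens M) {k : ℕ} (α : Form I M k) :
    mvI I U V (k + 1) (d I M k α) = mvD I U V k (mvI I U V k α) :=
  Prod.ext (d_pullback _ k α).symm (d_pullback _ k α).symm

theorem mvJ_mvD (U V : Opens M) {k : ℕ} (β : Form I U k × Form I V k) :
    mvJ I U V (k + 1) (mvD I U V k β) = d I (U ⊓ V : Opens M) k (mvJ I U V k β) := by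
  change _ - _ = d I (U ⊓ V : Opens M) k (_ - _)
  rw [map_sub]
  exact congrArg₂ _ (d_pullback _ k _).symm (d_pullback _ k _).symm

theorem mvJ_mvI (U V : Opens M) {k : ℕ} (α : Form I M k) :
    mvJ I U V k (mvI I U V k α) = 0 := by
  rw [mvJ_eq_zero_iff]
  refine Form.ext fun x => ?_
  rw [pullback_incl_apply, pullback_incl_apply]
  exact (pullback_inclM_apply U α ⟨x.1, x.2.1⟩).trans (pullback_inclM_apply V α ⟨x.1, x.2.2⟩).symm

theorem mvI_injective {U V : Opens M} (hUV : U ⊔ V = ⊤) (k : ℕ) :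
    Function.Injective (mvI I U V k) := by
  intro α β h
  refine Form.ext fun x => ?_
  have hx : x ∈ U ⊔ V := hUV ▸ trivial
  rcases hx with hx | hx
  · have h1 := congrArg (fun γ : Form I U k => γ.1 ⟨x, hx⟩) (congrArg Prod.fst h)
    exact (pullback_inclM_apply U α ⟨x, hx⟩).symm.trans
      (h1.trans (pullback_inclM_apply U β ⟨x, hx⟩))
  · have h1 := congrArg (fun γ : Form I V k => γ.1 ⟨x, hx⟩) (congrArg Prod.snd h)
    exact (pullback_inclM_apply V α ⟨x, hx⟩).symm.trans
      (h1.trans (pullback_inclM_apply V β ⟨x, hx⟩))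

open Classical in
/-- The field on `M` that is `α` on `U`, `β` on `V \ U`, and zero elsewhere. -/
def glueField {U V : Opens M} {k : ℕ} (α : FormField I U k) (β : FormField I V k) :
    FormField I M k := fun x =>
  if hU : x ∈ U then (α ⟨x, hU⟩ : E [⋀^Fin k]→L[ℝ] ℝ)
  else if hV : x ∈ V then (β ⟨x, hV⟩ : E [⋀^Fin k]→L[ℝ] ℝ) else 0

/-- Forms on `U` and `V` that agree on `U ∩ V` come from a form on `M = U ∪ V`. -/
theorem exists_mvI_eq {U V : Opens M} (hUV : U ⊔ V = ⊤) {k : ℕ}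
    {β : Form I U k × Form I V k} (hβ : mvJ I U V k β = 0) : ∃ α, mvI I U V k α = β := by
  rw [mvJ_eq_zero_iff] at hβ
  have hU : pullbackField (I := I) (inclM I U) (glueField β.1.1 β.2.1) = β.1.1 := by
    funext x
    refine ((isChartInclusion_inclM U).pullbackField_apply _ x).trans ?_
    exact dif_pos x.2
  have hV : pullbackField (I := I) (inclM I V) (glueField β.1.1 β.2.1) = β.2.1 := by
    funext x
    refine ((isChartInclusion_inclM V).pullbackField_apply _ x).trans ?_
    by_cases hx : x.1 ∈ U
    · have h := congrArg (fun γ : Form I (U ⊓ V : Opens M) k => γ.1 ⟨x.1, hx, x.2⟩) hβ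
      refine (dif_pos hx).trans ?_
      exact (pullback_incl_apply (inf_le_left : U ⊓ V ≤ U) β.1 ⟨x.1, hx, x.2⟩).symm.trans
        (h.trans (pullback_incl_apply (inf_le_right : U ⊓ V ≤ V) β.2 ⟨x.1, hx, x.2⟩))
    · exact (dif_neg hx).trans (dif_pos x.2)
  have hs : glueField β.1.1 β.2.1 ∈ smoothForms I M k := by
    refine mem_smoothForms_of_smoothFormAt fun x => ?_
    have hx : x ∈ U ⊔ V := hUV ▸ trivial
    rcases hx with hx | hx
    · refine ((isChartInclusion_inclM U).smoothFormAt_pullbackField_iff _ ⟨x, hx⟩).1 ?_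
      rw [hU]
      exact smoothFormAt_of_mem β.1.2 _
    · refine ((isChartInclusion_inclM V).smoothFormAt_pullbackField_iff _ ⟨x, hx⟩).1 ?_
      rw [hV]
      exact smoothFormAt_of_mem β.2.2 _
  exact ⟨⟨_, hs⟩, Prod.ext (Subtype.ext hU) (Subtype.ext hV)⟩

open Classical in
/-- If `W ⊆ U` are open and the smooth function `ρ` on `M` vanishes near every point outside `V`,
where `U ∩ V ⊆ W`, then `ρ σ`, extended by zero, is a smooth form on `U` for every form `σ` on
`W`. -/
theorem exists_extension_smul {U V W : Opens M} (hWU : W ≤ U) (hUV : U ⊓ V ≤ W) {ρ : M → ℝ}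
    (hρ : ContMDiff I 𝓘(ℝ) ∞ ρ) (hV : ∀ x ∉ V, ∀ᶠ z in 𝓝 x, ρ z = 0) {k : ℕ} (σ : Form I W k) :
    ∃ τ : Form I U k, ∀ x : W, (pullback (incl I hWU) k τ).1 x = ρ x.1 • σ.1 x := by
  let τ : FormField I U k := fun x =>
    if hx : x.1 ∈ W then ρ x.1 • (σ.1 ⟨x.1, hx⟩ : E [⋀^Fin k]→L[ℝ] ℝ) else 0
  have hτ : pullbackField (I := I) (incl I hWU) τ = fun x => ρ x.1 • σ.1 x := by
    funext x
    refine ((isChartInclusion_incl hWU).pullbackField_apply _ x).trans ?_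
    exact dif_pos x.2
  have hs : τ ∈ smoothForms I U k := by
    refine mem_smoothForms_of_smoothFormAt fun x => ?_
    by_cases hx : x.1 ∈ W
    · refine ((isChartInclusion_incl hWU).smoothFormAt_pullbackField_iff τ ⟨x.1, hx⟩).1 ?_
      rw [hτ]
      exact (smoothFormAt_of_mem σ.2 _).smul
        ((hρ.comp (contMDiff_subtype_val (U := W))).contMDiffAt)
    · have hxV : x.1 ∉ V := fun h => hx (hUV ⟨x.2, h⟩)
      refine (SmoothFormAt.zero x).congr ?_
      filter_upwards [continuous_subtype_val.continuousAt.eventually (hV x.1 hxV)] with z hz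
      by_cases hzW : z.1 ∈ W
      · refine (dif_pos hzW).trans ?_
        rw [hz, zero_smul]
        rfl
      · exact dif_neg hzW
  exact ⟨⟨τ, hs⟩, fun x => congrFun hτ x⟩

/-- With a partition of unity `(1 - ρ, ρ)`, where `ρ` vanishes near `M \ U` and `1 - ρ` near
`M \ V`, a form `σ` on `U ∩ V` is the difference of `(1 - ρ) σ` on `U` and `-ρ σ` on `V`. -/
theorem mvJ_surjective [T2Space M] [SecondCountableTopology M] {U V : Opens M}
    (hUV : U ⊔ V = ⊤) (k : ℕ) : Function.Surjective (mvJ I U V k) := by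
  intro σ
  have : LocallyCompactSpace M := Manifold.locallyCompact_of_finiteDimensional I
  have hd : Disjoint (U : Set M)ᶜ (V : Set M)ᶜ := by
    rw [Set.disjoint_left]
    intro x hxU hxV
    have hx : x ∈ U ⊔ V := hUV ▸ trivial
    exact hx.elim hxU hxV
  obtain ⟨ρ, hρU, hρV, -⟩ := exists_contMDiffMap_zero_one_nhds_of_isClosed (n := ⊤) I
    U.isOpen.isClosed_compl V.isOpen.isClosed_compl hd
  rw [Filter.Eventually, mem_nhdsSet_iff_forall] at hρU hρV
  have hρ : ContMDiff I 𝓘(ℝ) ∞ ρ := ρ.contMDiff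
  obtain ⟨τ, hτ⟩ := exists_extension_smul (inf_le_left : U ⊓ V ≤ U) le_rfl
    (ρ := fun x => 1 - ρ x) (contMDiff_const.sub hρ)
    (fun x hx => by filter_upwards [hρV x hx] with z hz; simp [show ρ z = 1 from hz]) σ
  obtain ⟨η, hη⟩ := exists_extension_smul (inf_le_right : U ⊓ V ≤ V) (inf_comm V U).le
    (ρ := fun x => -ρ x) hρ.neg
    (fun x hx => by filter_upwards [hρU x hx] with z hz; simp [show ρ z = 0 from hz]) σ
  refine ⟨(τ, η), Form.ext fun x => ?_⟩
  change (pullback (incl I inf_le_left) k τ).1 x - (pullback (incl I inf_le_right) k η).1 x = _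
  rw [hτ, hη]
  refine (sub_smul (1 - ρ x.1) (-ρ x.1) (σ.1 x : E [⋀^Fin k]→L[ℝ] ℝ)).symm.trans ?_
  rw [sub_neg_eq_add, sub_add_cancel, one_smul]

end ShortExact

/-! ### Cohomology classes -/

section Cohomology

variable {E : Type*} [NormedAddCommGroup E] [NormedSpace ℝ E]
  {H : Type*} [TopologicalSpace H] {I : ModelWithCorners ℝ E H}
  {M : Type*} [TopologicalSpace M] [ChartedSpace H M] [IsManifold I ∞ M]
  {U V : Opens M} {k : ℕ}

theorem cohomologyClass_surjective :
    Function.Surjective (cohomologyClass (I := I) (M := M) (k := k)) :=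
  Submodule.mkQ_surjective _

theorem cohomologyClass_eq_zero_iff (α : closedForms I M k) :
    cohomologyClass α = 0 ↔ (α : Form I M k) ∈ exactForms I M k := by
  rw [← map_zero cohomologyClass, cohomologyClass_eq_iff, ZeroMemClass.coe_zero, sub_zero]

theorem mvD_eq_zero_iff (β : Form I U k × Form I V k) :
    mvD I U V k β = 0 ↔ β.1 ∈ closedForms I U k ∧ β.2 ∈ closedForms I V k :=
  Prod.ext_iff

theorem mvD_mvD (β : Form I U k × Form I V k) : mvD I U V (k + 1) (mvD I U V k β) = 0 :=
  Prod.ext (d_d I U k β.1) (d_d I V k β.2)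

end Cohomology

/-! ### The long exact sequence -/

section LongExact

variable {E : Type*} [NormedAddCommGroup E] [NormedSpace ℝ E] [FiniteDimensional ℝ E]
  {H : Type*} [TopologicalSpace H] {I : ModelWithCorners ℝ E H}
  {M : Type*} [TopologicalSpace M] [ChartedSpace H M] [IsManifold I ∞ M]
  {U V : Opens M} {k : ℕ}

theorem exact_mvI_mvJ (hUV : U ⊔ V = ⊤) (k : ℕ) :
    Function.Exact (mvI I U V k) (mvJ I U V k) := fun _ =>
  ⟨exists_mvI_eq hUV, by rintro ⟨α, rfl⟩; exact mvJ_mvI U V α⟩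

theorem mem_closedForms_of_mvI (hUV : U ⊔ V = ⊤) {α : Form I M k}
    (h : mvD I U V k (mvI I U V k α) = 0) : α ∈ closedForms I M k := by
  rw [← mvI_d] at h
  exact (map_eq_zero_iff _ (mvI_injective hUV _)).1 h

theorem mvIStar_cohomologyClass_eq_iff (α : closedForms I M k) (a : closedForms I U k)
    (b : closedForms I V k) :
    mvIStar I U V k (cohomologyClass α) = (cohomologyClass a, cohomologyClass b) ↔
      (mvI I U V k α - (a.1, b.1)).1 ∈ exactForms I U k ∧
      (mvI I U V k α - (a.1, b.1)).2 ∈ exactForms I V k :=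
  Prod.ext_iff.trans (and_congr (cohomologyClass_eq_iff (pullbackClosed (inclM I U) k α) a)
    (cohomologyClass_eq_iff (pullbackClosed (inclM I V) k α) b))

theorem mvIStar_cohomologyClass_eq_zero_iff (α : closedForms I M k) :
    mvIStar I U V k (cohomologyClass α) = 0 ↔
      (mvI I U V k α).1 ∈ exactForms I U k ∧ (mvI I U V k α).2 ∈ exactForms I V k :=
  Prod.ext_iff.trans (and_congr (cohomologyClass_eq_zero_iff (pullbackClosed (inclM I U) k α))
    (cohomologyClass_eq_zero_iff (pullbackClosed (inclM I V) k α)))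

theorem mvJStar_cohomologyClass_eq_iff (a : closedForms I U k) (b : closedForms I V k)
    (σ : closedForms I (U ⊓ V : Opens M) k) :
    mvJStar I U V k (cohomologyClass a, cohomologyClass b) = cohomologyClass σ ↔
      mvJ I U V k (a.1, b.1) - σ ∈ exactForms I (U ⊓ V : Opens M) k := by
  refine Iff.trans ?_ (cohomologyClass_eq_iff (pullbackClosed (incl I inf_le_left) k a -
    pullbackClosed (incl I (inf_le_right : U ⊓ V ≤ V)) k b) σ)
  rw [map_sub]
  rfl

/-- In degree `0` there are no exact forms but zero. -/
theorem mvIStar_zero_injective (hUV : U ⊔ V = ⊤) : Function.Injective (mvIStar I U V 0) := by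
  rw [← LinearMap.ker_eq_bot, LinearMap.ker_eq_bot']
  intro a ha
  obtain ⟨α, rfl⟩ := cohomologyClass_surjective a
  obtain ⟨h1, h2⟩ := (mvIStar_cohomologyClass_eq_zero_iff α).1 ha
  have h : mvI I U V 0 α = 0 := Prod.ext h1 h2
  rw [map_eq_zero_iff _ (mvI_injective hUV 0)] at h
  rw [cohomologyClass_eq_zero_iff, h]
  exact Submodule.zero_mem _

variable [T2Space M] [SecondCountableTopology M]

/-- An exact form on `U ∩ V` is the image under `j` of a pair of exact forms, since a primitive of
it can be lifted. -/
theorem exists_exact_mvJ_eq (hUV : U ⊔ V = ⊤) {σ : Form I (U ⊓ V : Opens M) k}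
    (hσ : σ ∈ exactForms I (U ⊓ V : Opens M) k) :
    ∃ β : Form I U k × Form I V k,
      β.1 ∈ exactForms I U k ∧ β.2 ∈ exactForms I V k ∧ mvJ I U V k β = σ := by
  cases k with
  | zero =>
    have hσ' : σ = 0 := hσ
    exact ⟨0, Submodule.zero_mem _, Submodule.zero_mem _, by rw [map_zero, hσ']⟩
  | succ k =>
    obtain ⟨τ, rfl⟩ := hσ
    obtain ⟨β, rfl⟩ := mvJ_surjective hUV k τ
    exact ⟨mvD I U V k β, ⟨β.1, rfl⟩, ⟨β.2, rfl⟩, mvJ_mvD U V β⟩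

/-- Every closed form `σ` on `U ∩ V` is related to a closed form `γ` on `M` by `σ = j β` and
`i γ = d β` for some `β`. -/
theorem exists_mvJ_eq_and_mvI_eq_mvD (hUV : U ⊔ V = ⊤) (σ : closedForms I (U ⊓ V : Opens M) k) :
    ∃ (β : Form I U k × Form I V k) (γ : closedForms I M (k + 1)),
      mvJ I U V k β = σ ∧ mvI I U V (k + 1) γ = mvD I U V k β := by
  obtain ⟨β, hβ⟩ := mvJ_surjective hUV k σ.1
  have hσ : d I (U ⊓ V : Opens M) k σ = 0 := σ.2
  obtain ⟨γ, hγ⟩ := exists_mvI_eq hUV (β := mvD I U V k β) (by rw [mvJ_mvD, hβ, hσ])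
  exact ⟨β, ⟨γ, mem_closedForms_of_mvI hUV (by rw [hγ, mvD_mvD])⟩, hβ, hγ⟩

/-- The connecting homomorphism is well defined: if `σ = j β` is exact and `i γ = d β`, then `γ` is
exact. -/
theorem mem_exactForms_of_mvD_eq (hUV : U ⊔ V = ⊤) {β : Form I U k × Form I V k}
    {γ : Form I M (k + 1)} (hβ : mvJ I U V k β ∈ exactForms I (U ⊓ V : Opens M) k)
    (hγ : mvI I U V (k + 1) γ = mvD I U V k β) : γ ∈ exactForms I M (k + 1) := by
  obtain ⟨β', h1, h2, h3⟩ := exists_exact_mvJ_eq hUV hβ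
  obtain ⟨α, hα⟩ := exists_mvI_eq hUV (β := β - β') (by rw [map_sub, h3, sub_self])
  refine ⟨α, mvI_injective hUV _ ?_⟩
  have h4 : mvD I U V k β' = 0 := (mvD_eq_zero_iff β').2
    ⟨exactForms_le_closedForms I U k h1, exactForms_le_closedForms I V k h2⟩
  rw [mvI_d, hα, map_sub, h4, sub_zero, hγ]

variable (I U V k) in
/-- The connecting homomorphism `[σ] ↦ [i⁻¹ d s σ]`, where `s` is a linear section of `j`. The class
does not depend on `s`, nor on the choice of `β` with `j β = σ`. -/
theorem exists_connecting (hUV : U ⊔ V = ⊤) :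
    ∃ δ : Cohomology I (U ⊓ V : Opens M) k →ₗ[ℝ] Cohomology I M (k + 1),
      ∀ (α : closedForms I (U ⊓ V : Opens M) k) (β : Form I U k × Form I V k)
        (γ : closedForms I M (k + 1)), mvJ I U V k β = α →
        mvI I U V (k + 1) γ = mvD I U V k β → δ (cohomologyClass α) = cohomologyClass γ := by
  obtain ⟨s, hs⟩ := (mvJ I U V k).exists_rightInverse_of_surjective
    (LinearMap.range_eq_top.2 (mvJ_surjective hUV k))
  obtain ⟨r, hr⟩ := (mvI I U V (k + 1)).exists_leftInverse_of_injective
    (LinearMap.ker_eq_bot.2 (mvI_injective hUV (k + 1)))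
  have hs' : ∀ σ, mvJ I U V k (s σ) = σ := fun σ => LinearMap.congr_fun hs σ
  have hir : ∀ σ : closedForms I (U ⊓ V : Opens M) k,
      mvI I U V (k + 1) (r (mvD I U V k (s σ))) = mvD I U V k (s σ) := by
    intro σ
    have hσ : d I (U ⊓ V : Opens M) k σ = 0 := σ.2
    obtain ⟨γ, hγ⟩ := exists_mvI_eq hUV (β := mvD I U V k (s σ)) (by rw [mvJ_mvD, hs', hσ])
    have hrγ : r (mvI I U V (k + 1) γ) = γ := LinearMap.congr_fun hr γ
    rw [← hγ, hrγ]
  let δ₀ : closedForms I (U ⊓ V : Opens M) k →ₗ[ℝ] closedForms I M (k + 1) :=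
    (r ∘ₗ mvD I U V k ∘ₗ s ∘ₗ Submodule.subtype _).codRestrict _ fun σ =>
      mem_closedForms_of_mvI hUV (by
        change mvD I U V (k + 1) (mvI I U V (k + 1) (r (mvD I U V k (s σ)))) = 0
        rw [hir, mvD_mvD])
  have hδ₀ : ∀ σ, mvI I U V (k + 1) (δ₀ σ) = mvD I U V k (s σ) := hir
  refine ⟨Submodule.mapQ _ _ δ₀ fun σ hσ =>
    mem_exactForms_of_mvD_eq hUV (β := s σ) (by rw [hs']; exact hσ) (hδ₀ σ), ?_⟩
  intro α β γ hβ hγ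
  refine (cohomologyClass_eq_iff (δ₀ α) γ).2 ?_
  refine mem_exactForms_of_mvD_eq hUV (β := s α - β) ?_ ?_
  · rw [map_sub, hs', hβ, sub_self]
    exact Submodule.zero_mem _
  · rw [map_sub, map_sub, hδ₀, hγ]

theorem exact_mvIStar_mvJStar (hUV : U ⊔ V = ⊤) :
    Function.Exact (mvIStar I U V k) (mvJStar I U V k) := by
  rintro ⟨a, b⟩
  obtain ⟨a, rfl⟩ := cohomologyClass_surjective a
  obtain ⟨b, rfl⟩ := cohomologyClass_surjective b
  rw [← map_zero cohomologyClass, mvJStar_cohomologyClass_eq_iff, ZeroMemClass.coe_zero, sub_zero]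
  constructor
  · intro h
    obtain ⟨β, h1, h2, h3⟩ := exists_exact_mvJ_eq hUV h
    obtain ⟨α, hα⟩ := exists_mvI_eq hUV (β := (a.1, b.1) - β) (by rw [map_sub, h3, sub_self])
    have hαc : α ∈ closedForms I M k := by
      refine mem_closedForms_of_mvI hUV ?_
      rw [hα, mvD_eq_zero_iff]
      exact ⟨Submodule.sub_mem _ a.2 (exactForms_le_closedForms I U k h1),
        Submodule.sub_mem _ b.2 (exactForms_le_closedForms I V k h2)⟩
    refine ⟨cohomologyClass ⟨α, hαc⟩, (mvIStar_cohomologyClass_eq_iff _ a b).2 ?_⟩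
    rw [hα, sub_sub_cancel_left]
    exact ⟨Submodule.neg_mem _ h1, Submodule.neg_mem _ h2⟩
  · rintro ⟨c, hc⟩
    obtain ⟨α, rfl⟩ := cohomologyClass_surjective c
    obtain ⟨h1, h2⟩ := (mvIStar_cohomologyClass_eq_iff α a b).1 hc
    have h3 := Submodule.sub_mem _ (pullback_mem_exactForms (incl I inf_le_left) k h1)
      (pullback_mem_exactForms (incl I (inf_le_right : U ⊓ V ≤ V)) k h2)
    have h4 : mvJ I U V k (mvI I U V k α - (a.1, b.1)) ∈ exactForms I (U ⊓ V : Opens M) k := h3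
    rw [map_sub, mvJ_mvI, zero_sub] at h4
    exact (Submodule.neg_mem_iff _).1 h4

variable {δ : Cohomology I (U ⊓ V : Opens M) k →ₗ[ℝ] Cohomology I M (k + 1)}

theorem exact_mvJStar_connecting (hUV : U ⊔ V = ⊤)
    (hδ : ∀ (α : closedForms I (U ⊓ V : Opens M) k) (β : Form I U k × Form I V k)
      (γ : closedForms I M (k + 1)), mvJ I U V k β = α →
      mvI I U V (k + 1) γ = mvD I U V k β → δ (cohomologyClass α) = cohomologyClass γ) :
    Function.Exact (mvJStar I U V k) δ := by
  intro c
  obtain ⟨σ, rfl⟩ := cohomologyClass_surjective c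
  constructor
  · intro h
    obtain ⟨β, γ, hβ, hγ⟩ := exists_mvJ_eq_and_mvI_eq_mvD hUV σ
    rw [hδ σ β γ hβ hγ, cohomologyClass_eq_zero_iff] at h
    obtain ⟨α, hα⟩ := h
    have hα' : d I M k α = γ := hα
    have hc : mvD I U V k (β - mvI I U V k α) = 0 := by
      rw [map_sub, ← mvI_d, hα', hγ, sub_self]
    obtain ⟨h1, h2⟩ := (mvD_eq_zero_iff _).1 hc
    refine ⟨(cohomologyClass ⟨_, h1⟩, cohomologyClass ⟨_, h2⟩),
      (mvJStar_cohomologyClass_eq_iff _ _ σ).2 ?_⟩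
    rw [Prod.mk.eta, map_sub, mvJ_mvI, sub_zero, hβ, sub_self]
    exact Submodule.zero_mem _
  · rintro ⟨⟨a, b⟩, hab⟩
    obtain ⟨a, rfl⟩ := cohomologyClass_surjective a
    obtain ⟨b, rfl⟩ := cohomologyClass_surjective b
    have hab₀ : mvD I U V k (a.1, b.1) = 0 := (mvD_eq_zero_iff _).2 ⟨a.2, b.2⟩
    have hτ : mvJ I U V k (a.1, b.1) ∈ closedForms I (U ⊓ V : Opens M) k := by
      change d I (U ⊓ V : Opens M) k _ = 0
      rw [← mvJ_mvD, hab₀, map_zero]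
    have h : mvJStar I U V k (cohomologyClass a, cohomologyClass b) = cohomologyClass ⟨_, hτ⟩ := by
      rw [mvJStar_cohomologyClass_eq_iff, sub_self]
      exact Submodule.zero_mem _
    rw [← hab, h, hδ ⟨_, hτ⟩ (a.1, b.1) 0 rfl, map_zero]
    rw [hab₀, ZeroMemClass.coe_zero, map_zero]

theorem exact_connecting_mvIStar (hUV : U ⊔ V = ⊤)
    (hδ : ∀ (α : closedForms I (U ⊓ V : Opens M) k) (β : Form I U k × Form I V k)
      (γ : closedForms I M (k + 1)), mvJ I U V k β = α →
      mvI I U V (k + 1) γ = mvD I U V k β → δ (cohomologyClass α) = cohomologyClass γ) :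
    Function.Exact δ (mvIStar I U V (k + 1)) := by
  intro c
  obtain ⟨γ, rfl⟩ := cohomologyClass_surjective c
  rw [mvIStar_cohomologyClass_eq_zero_iff]
  constructor
  · rintro ⟨⟨a, ha⟩, ⟨b, hb⟩⟩
    have hab : mvI I U V (k + 1) γ = mvD I U V k (a, b) := Prod.ext ha.symm hb.symm
    have hσ : mvJ I U V k (a, b) ∈ closedForms I (U ⊓ V : Opens M) k := by
      change d I (U ⊓ V : Opens M) k _ = 0
      rw [← mvJ_mvD, ← hab, mvJ_mvI]
    exact ⟨cohomologyClass ⟨_, hσ⟩, hδ _ (a, b) γ rfl hab⟩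
  · rintro ⟨c, hc⟩
    obtain ⟨σ, rfl⟩ := cohomologyClass_surjective c
    obtain ⟨β, γ', hβ, hγ'⟩ := exists_mvJ_eq_and_mvI_eq_mvD hUV σ
    rw [hδ σ β γ' hβ hγ', eq_comm] at hc
    rw [← mvIStar_cohomologyClass_eq_zero_iff, hc, mvIStar_cohomologyClass_eq_zero_iff]
    rw [hγ']
    exact ⟨⟨β.1, rfl⟩, ⟨β.2, rfl⟩⟩

end LongExact

end DeRham

end

theorem theorem3p1
    {E : Type*} [NormedAddCommGroup E] [NormedSpace ℝ E] [FiniteDimensional ℝ E]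
    {H : Type*} [TopologicalSpace H] (I : ModelWithCorners ℝ E H)
    {M : Type*} [TopologicalSpace M] [T2Space M] [SecondCountableTopology M]
    [ChartedSpace H M] [IsManifold I ∞ M]
    (U V : Opens M) (hUV : U ⊔ V = ⊤) :
    -- `i` and `j` are maps of cochain complexes
    (∀ k (α : DeRham.Form I M k),
      DeRham.mvI I U V (k + 1) (DeRham.d I M k α) =
        DeRham.mvD I U V k (DeRham.mvI I U V k α)) ∧
    (∀ k (β : DeRham.Form I U k × DeRham.Form I V k),
      DeRham.mvJ I U V (k + 1) (DeRham.mvD I U V k β) =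
        DeRham.d I (U ⊓ V : Opens M) k (DeRham.mvJ I U V k β)) ∧
    -- `0 → Ω^k(M) → Ω^k(U) ⊕ Ω^k(V) → Ω^k(U ∩ V) → 0` is exact for every `k`
    (∀ k, Function.Injective (DeRham.mvI I U V k) ∧
      Function.Exact (DeRham.mvI I U V k) (DeRham.mvJ I U V k) ∧
      Function.Surjective (DeRham.mvJ I U V k)) ∧
    -- the long exact sequence
    ∃ δ : ∀ k, DeRham.Cohomology I (U ⊓ V : Opens M) k →ₗ[ℝ] DeRham.Cohomology I M (k + 1),
      -- `δ` is the connecting homomorphism: if `j β = α` and `i γ = d β` then `δ [α] = [γ]`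
      (∀ k (α : DeRham.closedForms I (U ⊓ V : Opens M) k)
        (β : DeRham.Form I U k × DeRham.Form I V k) (γ : DeRham.closedForms I M (k + 1)),
        DeRham.mvJ I U V k β = α → DeRham.mvI I U V (k + 1) γ = DeRham.mvD I U V k β →
          δ k (DeRham.cohomologyClass α) = DeRham.cohomologyClass γ) ∧
      Function.Injective (DeRham.mvIStar I U V 0) ∧
      ∀ k, Function.Exact (DeRham.mvIStar I U V k) (DeRham.mvJStar I U V k) ∧
        Function.Exact (DeRham.mvJStar I U V k) (δ k) ∧
        Function.Exact (δ k) (DeRham.mvIStar I U V (k + 1)) := by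
  choose δ hδ using fun k => DeRham.exists_connecting I U V k hUV
  exact ⟨fun _ α => DeRham.mvI_d U V α, fun _ β => DeRham.mvJ_mvD U V β,
    fun k => ⟨DeRham.mvI_injective hUV k, DeRham.exact_mvI_mvJ hUV k,
      DeRham.mvJ_surjective hUV k⟩,
    δ, hδ, DeRham.mvIStar_zero_injective hUV,
    fun k => ⟨DeRham.exact_mvIStar_mvJStar hUV, DeRham.exact_mvJStar_connecting hUV (hδ k),
      DeRham.exact_connecting_mvIStar hUV (hδ k)⟩⟩
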